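/- Let $p$ be an odd prime, $m\ge 1$ an integer, $G=(\mathbb Z/p\mathbb Z)^m$, and let $\widehat G$ be the group of homomorphisms from $G$ to the unit circle $S^1$. Let $\mathcal F:\mathbb C^G\to\mathbb C^{\widehat G}$ be the Fourier transform $\mathcal F(f)(\chi)=|G|^{-1/2}\sum_{g\in G}f(g)\chi(g)$, and for a group isomorphism $j:G\to\widehat G$ let $\tilde j:\mathbb C^{\widehat G}\to\mathbb C^G$ be $(\tilde j\phi)(g)=\phi(j(g))$. The matrix of $j$ is the $m\times m$ matrix $M_j$ over $\mathbb Z/p\mathbb Z$ such that $j(g)(h)=e^{2\pi i\langle h,M_jg\rangle/p}$ for all $g,h\in G$, where $\langle h,g\rangle=h_1g_1+\dots+h_mg_m$; call $j$ symmetric if $M_j^t=M_j$. Let $R_4=\{1,-1,i,-i\}$, let $\mathbb Z[R_4]$ be its integral group algebra with basis $[\alpha]$, $\alpha\in R_4$, and let $s=[1]+[-1]+[i]+[-i]$. An element $\sum_{\alpha\in R_4}a_\alpha[\alpha]\in\mathbb Z[R_4]$ represents the spectrum of a linear operator $A$ if $A^4=\mathrm{id}$ and, for every $\alpha\in R_4$,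 $a_\alpha$ is the multiplicity of $\alpha$ as an eigenvalue of $A$ (so $a_\alpha=0$ if $\alpha$ is not an eigenvalue). (1) If $p\equiv 1\pmod 4$, then for every symmetric isomorphism $j:G\to\widehat G$ the spectrum of $\tilde j\circ\mathcal F:\mathbb C^G\to\mathbb C^G$ is represented by $\frac{p^m-1}{4}s+[1]$ or by $\frac{p^m-1}{4}s+[-1]$. Each of the two cases occurs for some symmetric $j$. (2) If $p\equiv 3\pmod 4$, then for every symmetric isomorphism $j:G\to\widehat G$ the spectrum of $\tilde j\circ\mathcal F$ is represented by $\frac{p^m-(-1)^m}{4}s+(-1)^m[i^m]$ or by $\frac{p^m-(-1)^m}{4}s+(-1)^m[-i^m]$. Each of the two cases occurs for some symmetric $j$. -/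

import Mathlib

open scoped Matrix

noncomputable section

namespace FourierIso

section Transform

variable {G : Type*} [AddCommGroup G]

/-- The unitary Fourier transform `ℂ^G → ℂ^Ĝ` of a finite abelian group `G`, where
`Ĝ = AddChar G Circle` is the group of homomorphisms from `G` to the unit circle:
`𝓕 f χ = |G|^(-1/2) ∑ g, f g * χ g` (no complex conjugation). -/
def fourier [Fintype G] : (G → ℂ) →ₗ[ℂ] (AddChar G Circle → ℂ) where
  toFun f χ := ((√(Fintype.card G : ℝ) : ℝ) : ℂ)⁻¹ * ∑ g : G, f g * (χ g : ℂ)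
  map_add' f₁ f₂ := by
    funext χ
    simp [add_mul, mul_add, Finset.sum_add_distrib]
  map_smul' c f := by
    funext χ
    simp [Finset.mul_sum, mul_assoc, mul_left_comm]

/-- The pullback `ℂ^Ĝ → ℂ^G`, `φ ↦ φ ∘ j`, along a map `j : G → Ĝ`. -/
def pullback (j : G → AddChar G Circle) : (AddChar G Circle → ℂ) →ₗ[ℂ] (G → ℂ) where
  toFun φ g := φ (j g)
  map_add' _ _ := rfl
  map_smul' _ _ := rfl

/-- The concrete Fourier transform of `G` attached to an isomorphism `j : G ≅ Ĝ`: the composition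
of the Fourier transform with the pullback along `j`. (The addition on `AddChar G Circle` is
pointwise multiplication of characters.) -/
def concreteFourier [Fintype G] (j : G ≃+ AddChar G Circle) : Module.End ℂ (G → ℂ) :=
  pullback j ∘ₗ fourier

end Transform

/-- `M` is the matrix of the isomorphism `j` from `(ℤ/n)^m` to its dual:
`j g h = e_n (⟨h, M g⟩)`, where `e_n x = exp (2πix/n)` and `⟨·,·⟩` is the standard
bilinear form. -/
def IsMatrixOf {n m : ℕ} [NeZero n]
    (j : (Fin m → ZMod n) ≃+ AddChar (Fin m → ZMod n) Circle)
    (M : Matrix (Fin m) (Fin m) (ZMod n)) : Prop :=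
  ∀ g h : Fin m → ZMod n, j g h = ZMod.toCircle (h ⬝ᵥ (M *ᵥ g))

/-- The group `{1, -1, i, -i}` of fourth roots of unity in `ℂ`. -/
abbrev R4 : Type := rootsOfUnity 4 ℂ

/-- `-1` as a fourth root of unity. -/
def negOne : R4 := rootsOfUnity.mkOfPowEq (-1 : ℂ) (by norm_num)

/-- `i` as a fourth root of unity. -/
def imag : R4 := rootsOfUnity.mkOfPowEq Complex.I Complex.I_pow_four

/-- The basis element `[α]` of the integral group algebra `ℤ[R4]`. -/
def br (α : R4) : MonoidAlgebra ℤ R4 := MonoidAlgebra.of ℤ R4 α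

/-- The element `s = [1] + [-1] + [i] + [-i]` of `ℤ[R4]`. -/
def s : MonoidAlgebra ℤ R4 := br 1 + br negOne + br imag + br (negOne * imag)

/-- `a ∈ ℤ[R4]` represents the spectrum of the operator `A`: one has `A ^ 4 = id`, and for each
fourth root of unity `α` the coefficient of `a` at `[α]` is the multiplicity of `α` as an
eigenvalue of `A`. (As `A ^ 4 = id`, the operator is diagonalizable with spectrum in `R4`, and
geometric and algebraic multiplicities agree.) -/
def RepresentsSpectrum {V : Type*} [AddCommGroup V] [Module ℂ V] (a : MonoidAlgebra ℤ R4)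
    (A : Module.End ℂ V) : Prop :=
  A ^ 4 = 1 ∧
    ∀ α : R4, a.coeff α = (Module.finrank ℂ (A.eigenspace ((α : ℂˣ) : ℂ)) : ℤ)

end FourierIso

end

/-! Write `A` for the operator and `q = p ^ m`. Symmetry of the pairing and orthogonality of
characters give `(A ^ 2 f)(g) = f(-g)`, so `A ^ 4 = 1`, and the multiplicities are determined by the
traces of `1, A, A ^ 2, A ^ 3`. These are `q`, `T`, `1` (in odd order only `0` is fixed by negation)
and the conjugate of `T`, where `T` is a normalized quadratic Gauss sum with `|T| = 1`.

No Gauss sum is evaluated. The multiplicities of `1` and `i` are integers, which together with `|T|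
= 1` forces `T ^ 2 = ε`, where `ε = ±1` and `q ≡ ε` modulo 4 (`trace_concreteFourier_sq_eq`). So `T`
has two possible values, each fixing the spectrum (`representsSpectrum_of_trace`). Both values
occur, because replacing one entry of a diagonal matrix by a nonsquare negates the Gauss sum
(`exists_opposite_quadraticSums`). -/

noncomputable section

namespace FourierIso

/-! ### Multiplicities from traces of powers -/

section SpectralMultiplicities

/-- An operator with `A ^ 4 = 1` has eigenvalue multiplicities given by the traces of its powers. -/
theorem four_mul_finrank_eigenspace {V : Type*} [AddCommGroup V] [Module ℂ V]
    [FiniteDimensional ℂ V] {A : Module.End ℂ V} (hA : A ^ 4 = 1) {α : ℂ} (hα : α ^ 4 = 1) :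
    4 * (Module.finrank ℂ (A.eigenspace α) : ℂ) =
      LinearMap.trace ℂ V 1 + α ^ 3 * LinearMap.trace ℂ V A +
        α ^ 2 * LinearMap.trace ℂ V (A ^ 2) + α * LinearMap.trace ℂ V (A ^ 3) := by
  -- The averaging projector onto the `α`-eigenspace: the coefficient of `A ^ k` is `α⁻ᵏ / 4`, with
  -- `α⁻ᵏ = α ^ (4 - k)`. Its trace is the dimension.
  set P : Module.End ℂ V := (1 / 4 : ℂ) • (1 + α ^ 3 • A + α ^ 2 • A ^ 2 + α • A ^ 3) with hP
  have hAP : A * P = α • P := by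
    have h4 : A * A ^ 3 = 1 := by rw [← pow_succ', hA]
    have h2 : A * A = A ^ 2 := (sq A).symm
    have h3 : A * A ^ 2 = A ^ 3 := (pow_succ' A 2).symm
    rw [hP, mul_smul_comm, smul_comm α, mul_add, mul_add, mul_add, mul_one, mul_smul_comm,
      mul_smul_comm, mul_smul_comm, h2, h3, h4]
    congr 1
    rw [smul_add, smul_add, smul_add, smul_smul, smul_smul, smul_smul,
      show α * α ^ 3 = 1 by rw [← pow_succ', hα]]
    module
  have hproj : LinearMap.IsProj (A.eigenspace α) P := by
    refine ⟨fun x => ?_, fun x hx => ?_⟩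
    · rw [Module.End.mem_eigenspace_iff]
      exact LinearMap.congr_fun hAP x
    · rw [Module.End.mem_eigenspace_iff] at hx
      have h2 : (A ^ 2) x = α ^ 2 • x := by
        rw [sq, Module.End.mul_apply, hx, map_smul, hx, smul_smul, sq]
      have h3 : (A ^ 3) x = α ^ 3 • x := by
        rw [pow_succ, Module.End.mul_apply, hx, map_smul, h2, smul_smul, pow_succ' α 2]
      simp only [hP, LinearMap.smul_apply, LinearMap.add_apply, Module.End.one_apply, hx, h2, h3,
        smul_smul]
      have e1 : α ^ 3 * α = 1 := by rw [← pow_succ, hα]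
      have e2 : α ^ 2 * α ^ 2 = 1 := by rw [← pow_add, hα]
      have e3 : α * α ^ 3 = 1 := by rw [← pow_succ', hα]
      rw [e1, e2, e3]
      module
  rw [← hproj.trace, hP]
  simp only [map_smul, map_add, smul_eq_mul]
  ring

theorem trace_eq_sum_single {ι : Type*} [Fintype ι] [DecidableEq ι]
    (f : Module.End ℂ (ι → ℂ)) :
    LinearMap.trace ℂ (ι → ℂ) f = ∑ i, f (Pi.single i 1) i := by
  rw [LinearMap.trace_eq_matrix_trace ℂ (Pi.basisFun ℂ ι)]
  simp [Matrix.trace]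

end SpectralMultiplicities

/-! ### Powers and traces for a symmetric pairing -/

section SymmetricPairing

variable {G : Type*} [AddCommGroup G] [Fintype G]

/-- The quadratic Gauss sum of the pairing attached to `j`. -/
def quadraticSum (j : G ≃+ AddChar G Circle) : ℂ := ∑ g, (j g g : ℂ)

theorem concreteFourier_apply (j : G ≃+ AddChar G Circle) (f : G → ℂ) (g : G) :
    concreteFourier j f g = ((√(Fintype.card G : ℝ) : ℝ) : ℂ)⁻¹ * ∑ h, f h * (j g h : ℂ) := rfl

theorem sum_pairing [DecidableEq G] (j : G ≃+ AddChar G Circle) (g : G) :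
    ∑ h, (j g h : ℂ) = if g = 0 then (Fintype.card G : ℂ) else 0 := by
  classical
  have h := AddChar.sum_eq_ite (AddChar.circleEquivComplex (j g))
  simp only [EmbeddingLike.map_eq_zero_iff] at h
  exact h

omit [AddCommGroup G] in
theorem ofReal_sqrt_card_inv_sq :
    (((√(Fintype.card G : ℝ) : ℝ) : ℂ)⁻¹) * ((√(Fintype.card G : ℝ) : ℝ) : ℂ)⁻¹ =
      (Fintype.card G : ℂ)⁻¹ := by
  rw [← mul_inv, ← Complex.ofReal_mul, Real.mul_self_sqrt (Nat.cast_nonneg _),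
    Complex.ofReal_natCast]

variable {j : G ≃+ AddChar G Circle}

/-- Symmetry merges `j h k * j g h` into `j (k + g) h`, and summing over `h` leaves only `k = -g`.
-/
theorem concreteFourier_sq_apply (hj : ∀ g h, j g h = j h g) (f : G → ℂ) (g : G) :
    (concreteFourier j ^ 2) f g = f (-g) := by
  classical
  have hq : (Fintype.card G : ℂ) ≠ 0 := Nat.cast_ne_zero.2 Fintype.card_ne_zero
  rw [sq, Module.End.mul_apply, concreteFourier_apply]
  simp only [concreteFourier_apply]
  have : ∀ h, ((√(Fintype.card G : ℝ) : ℝ) : ℂ)⁻¹ * (∑ k, f k * (j h k : ℂ)) * (j g h : ℂ) =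
      ((√(Fintype.card G : ℝ) : ℝ) : ℂ)⁻¹ * ∑ k, f k * (j (k + g) h : ℂ) := by
    intro h
    rw [mul_assoc, Finset.sum_mul]
    congr 1
    refine Finset.sum_congr rfl fun k _ => ?_
    rw [hj h k, map_add, AddChar.add_apply, Circle.coe_mul, mul_assoc]
  simp only [this]
  rw [← Finset.mul_sum, ← mul_assoc, ofReal_sqrt_card_inv_sq, Finset.sum_comm]
  simp only [← Finset.mul_sum, sum_pairing, add_eq_zero_iff_eq_neg]
  simp [mul_comm, hq]

theorem concreteFourier_pow_four (hj : ∀ g h, j g h = j h g) : concreteFourier j ^ 4 = 1 := by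
  refine LinearMap.ext fun f => funext fun g => ?_
  rw [show 4 = 2 + 2 from rfl, pow_add, Module.End.mul_apply, concreteFourier_sq_apply hj,
    concreteFourier_sq_apply hj, neg_neg, Module.End.one_apply]

theorem trace_concreteFourier (j : G ≃+ AddChar G Circle) :
    LinearMap.trace ℂ (G → ℂ) (concreteFourier j) =
      ((√(Fintype.card G : ℝ) : ℝ) : ℂ)⁻¹ * quadraticSum j := by
  classical
  rw [trace_eq_sum_single, quadraticSum, Finset.mul_sum]
  refine Finset.sum_congr rfl fun g _ => ?_
  simp [concreteFourier_apply, Pi.single_apply]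

/-- Since `A ^ 2` is reflection, the diagonal entries of `A ^ 3` involve `j (-g) g`, the conjugate
of `j g g`. -/
theorem trace_concreteFourier_cube (hj : ∀ g h, j g h = j h g) :
    LinearMap.trace ℂ (G → ℂ) (concreteFourier j ^ 3) =
      starRingEnd ℂ (LinearMap.trace ℂ (G → ℂ) (concreteFourier j)) := by
  classical
  rw [trace_concreteFourier, trace_eq_sum_single, quadraticSum, map_mul, map_inv₀,
    Complex.conj_ofReal, map_sum, Finset.mul_sum]
  refine Finset.sum_congr rfl fun g _ => ?_
  rw [pow_succ, Module.End.mul_apply, concreteFourier_sq_apply hj]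
  simp [concreteFourier_apply, Pi.single_apply, ← Circle.coe_inv_eq_conj, AddChar.map_neg_eq_inv]

theorem trace_concreteFourier_sq (hj : ∀ g h, j g h = j h g) (h2 : ∀ g : G, 2 • g = 0 → g = 0) :
    LinearMap.trace ℂ (G → ℂ) (concreteFourier j ^ 2) = 1 := by
  classical
  rw [trace_eq_sum_single, Finset.sum_eq_single (0 : G)]
  · simp [concreteFourier_sq_apply hj]
  · intro g _ hg
    rw [concreteFourier_sq_apply hj, Pi.single_eq_of_ne]
    intro h
    exact hg (h2 g (by rw [two_nsmul]; nth_rewrite 1 [← h]; simp))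
  · simp

/-- Substituting `g = u + h` cancels `j h h`, and by symmetry the two cross terms combine to `j (2 •
u) h`. Summing over `h` kills every `u` except `0`, as there is no 2-torsion. -/
theorem quadraticSum_mul_conj (hj : ∀ g h, j g h = j h g) (h2 : ∀ g : G, 2 • g = 0 → g = 0) :
    quadraticSum j * starRingEnd ℂ (quadraticSum j) = Fintype.card G := by
  classical
  have key : ∀ u h, (j (u + h) (u + h) : ℂ) * starRingEnd ℂ (j h h : ℂ) =
      (j u u : ℂ) * (j (2 • u) h : ℂ) := by
    intro u h
    rw [← Circle.coe_inv_eq_conj, ← Circle.coe_mul, ← Circle.coe_mul]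
    refine congrArg (fun z : Circle => (z : ℂ)) ?_
    rw [two_nsmul, map_add j u h, map_add j u u, AddChar.add_apply, AddChar.add_apply,
      AddChar.map_add_eq_mul, AddChar.map_add_eq_mul, hj h u]
    simp [mul_assoc]
  rw [quadraticSum, map_sum, Finset.sum_mul_sum, Finset.sum_comm]
  have : ∀ h, ∑ g, (j g g : ℂ) * starRingEnd ℂ (j h h : ℂ) =
      ∑ u, (j u u : ℂ) * (j (2 • u) h : ℂ) := by
    intro h
    rw [← Equiv.sum_comp (Equiv.addRight h)]
    exact Finset.sum_congr rfl fun u _ => key u h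
  simp only [this]
  rw [Finset.sum_comm]
  simp only [← Finset.mul_sum, sum_pairing]
  rw [Finset.sum_eq_single (0 : G)]
  · simp
  · intro u _ hu
    rw [if_neg (fun h => hu (h2 u h)), mul_zero]
  · simp

theorem trace_mul_conj (hj : ∀ g h, j g h = j h g) (h2 : ∀ g : G, 2 • g = 0 → g = 0) :
    LinearMap.trace ℂ (G → ℂ) (concreteFourier j) *
      starRingEnd ℂ (LinearMap.trace ℂ (G → ℂ) (concreteFourier j)) = 1 := by
  have hq : (Fintype.card G : ℂ) ≠ 0 := Nat.cast_ne_zero.2 Fintype.card_ne_zero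
  rw [trace_concreteFourier, map_mul, map_inv₀, Complex.conj_ofReal, mul_mul_mul_comm,
    ofReal_sqrt_card_inv_sq, quadraticSum_mul_conj hj h2, inv_mul_cancel₀ hq]

theorem four_mul_finrank_eigenspace_concreteFourier (hj : ∀ g h, j g h = j h g)
    (h2 : ∀ g : G, 2 • g = 0 → g = 0) {α : ℂ} (hα : α ^ 4 = 1) :
    4 * (Module.finrank ℂ ((concreteFourier j).eigenspace α) : ℂ) =
      Fintype.card G + α ^ 3 * LinearMap.trace ℂ (G → ℂ) (concreteFourier j) + α ^ 2 +
        α * starRingEnd ℂ (LinearMap.trace ℂ (G → ℂ) (concreteFourier j)) := by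
  rw [four_mul_finrank_eigenspace (concreteFourier_pow_four hj) hα, trace_concreteFourier_cube hj,
    trace_concreteFourier_sq hj h2, LinearMap.trace_one, Module.finrank_fintype_fun_eq_card, mul_one]

/-- Integrality of the eigenvalue multiplicities pins down the square of the trace. -/
theorem trace_concreteFourier_sq_eq (hj : ∀ g h, j g h = j h g)
    (h2 : ∀ g : G, 2 • g = 0 → g = 0) {c ε : ℤ} (hε : ε = 1 ∨ ε = -1)
    (hc : (Fintype.card G : ℤ) = 4 * c + ε) :
    LinearMap.trace ℂ (G → ℂ) (concreteFourier j) ^ 2 = ε := by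
  set T := LinearMap.trace ℂ (G → ℂ) (concreteFourier j) with hT
  have h1 := four_mul_finrank_eigenspace_concreteFourier hj h2 (α := 1) (by norm_num)
  have hI := four_mul_finrank_eigenspace_concreteFourier hj h2 (α := Complex.I) Complex.I_pow_four
  have hN := trace_mul_conj hj h2
  rw [← hT] at h1 hI hN
  generalize Module.finrank ℂ ((concreteFourier j).eigenspace 1) = n at h1
  generalize Module.finrank ℂ ((concreteFourier j).eigenspace Complex.I) = k at hI
  have hq : (Fintype.card G : ℝ) = 4 * c + ε := by exact_mod_cast hc
  have hre : 2 * T.re = 4 * n - Fintype.card G - 1 := by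
    have := congrArg Complex.re h1
    simp at this
    linarith
  have him : 2 * T.im = 4 * k - Fintype.card G + 1 := by
    have := congrArg Complex.re hI
    simp [pow_succ] at this
    linarith
  have hN' : T.re * T.re + T.im * T.im = 1 := by
    have := congrArg Complex.re hN
    simpa using this
  have hZ : (4 * (n : ℤ) - (4 * c + ε) - 1) ^ 2 + (4 * (k : ℤ) - (4 * c + ε) + 1) ^ 2 = 4 := by
    have : ((4 * n - Fintype.card G - 1) ^ 2 + (4 * k - Fintype.card G + 1) ^ 2 : ℝ) = 4 := by
      rw [← hre, ← him]
      linarith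
    rw [hq] at this
    exact_mod_cast this
  rcases hε with rfl | rfl
  · have hk : (k : ℤ) - c = 0 := by
      -- A product of consecutive integers is nonnegative, so both terms vanish and `T` is real; for
      -- `ε = -1` the roles of `n` and `k` swap and `T` is imaginary.
      have : ((n : ℤ) - c) * (n - c - 1) + (k - c) ^ 2 = 0 := by linarith
      have h0 : 0 ≤ ((n : ℤ) - c) * (n - c - 1) := by
        rcases le_or_gt ((n : ℤ) - c) 0 with h | h <;> nlinarith
      exact pow_eq_zero_iff two_ne_zero |>.1 (le_antisymm (by linarith) (sq_nonneg _))
    have him0 : T.im = 0 := by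
      have : ((k : ℤ) : ℝ) - c = 0 := by exact_mod_cast hk
      push_cast at this hq
      linarith
    rw [him0] at hN'
    apply Complex.ext <;> simp [sq, him0]
    linarith
  · have hn : (n : ℤ) - c = 0 := by
      have : ((k : ℤ) - c) * (k - c + 1) + (n - c) ^ 2 = 0 := by linarith
      have h0 : 0 ≤ ((k : ℤ) - c) * (k - c + 1) := by
        rcases le_or_gt 0 ((k : ℤ) - c) with h | h <;> nlinarith
      exact pow_eq_zero_iff two_ne_zero |>.1 (le_antisymm (by linarith) (sq_nonneg _))
    have hre0 : T.re = 0 := by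
      have : ((n : ℤ) : ℝ) - c = 0 := by exact_mod_cast hn
      push_cast at this hq
      linarith
    rw [hre0] at hN'
    apply Complex.ext <;> simp [sq, hre0]
    linarith

end SymmetricPairing

/-! ### From the trace to the element of `ℤ[R4]` -/

section Represents

theorem coeff_br (β α : R4) [Decidable (β = α)] : (br β).coeff α = if β = α then 1 else 0 := by
  classical
  simp only [br, MonoidAlgebra.of_apply]
  rw [MonoidAlgebra.coeff_single, Finsupp.single_apply]

theorem coe_injective_R4 {α β : R4} (h : ((α : ℂˣ) : ℂ) = ((β : ℂˣ) : ℂ)) : α = β :=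
  Subtype.ext (Units.ext h)

theorem coe_pow_four (α : R4) : ((α : ℂˣ) : ℂ) ^ 4 = 1 := by
  have := α.2
  rw [mem_rootsOfUnity] at this
  simpa using congrArg Units.val this

theorem coe_negOne : ((negOne : ℂˣ) : ℂ) = -1 := rootsOfUnity.coe_mkOfPowEq _

theorem coe_imag : ((imag : ℂˣ) : ℂ) = Complex.I := rootsOfUnity.coe_mkOfPowEq _

theorem eq_of_pow_four {z : ℂ} (hz : z ^ 4 = 1) :
    z = 1 ∨ z = -1 ∨ z = Complex.I ∨ z = -Complex.I := by
  have : (z - 1) * ((z + 1) * ((z - Complex.I) * (z + Complex.I))) = 0 := by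
    linear_combination hz - (z ^ 2 - 1) * Complex.I_sq
  simpa [sub_eq_zero, add_eq_zero_iff_eq_neg] using this

theorem coeff_s (α : R4) : s.coeff α = 1 := by
  classical
  have hI : Complex.I ≠ 1 := fun h => by simpa using congrArg Complex.re h
  have hI' : Complex.I ≠ -1 := fun h => by simpa using congrArg Complex.re h
  have e : ∀ β γ : R4, (β = γ) ↔ ((β : ℂˣ) : ℂ) = ((γ : ℂˣ) : ℂ) :=
    fun β γ => ⟨fun h => by rw [h], coe_injective_R4⟩
  have hnn : (1 : ℂ) ≠ -1 := by norm_num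
  have hnI : Complex.I ≠ -Complex.I := fun h => by
    have := congrArg Complex.im h
    norm_num at this
  have hI1 : -Complex.I ≠ 1 := fun h => hI' (by rw [← h, neg_neg])
  simp only [s, MonoidAlgebra.coeff_add, Finsupp.add_apply, coeff_br, e, Subgroup.coe_mul,
    Units.val_mul, coe_negOne, coe_imag, Subgroup.coe_one, Units.val_one]
  rcases eq_of_pow_four (coe_pow_four α) with h | h | h | h <;> rw [h] <;>
    simp [hI, hI', hnn, hnI, hI1, hI.symm, hI'.symm, hnn.symm, hnI.symm, hI1.symm]

variable {G : Type*} [AddCommGroup G] [Fintype G] {j : G ≃+ AddChar G Circle}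

theorem representsSpectrum_of_trace (hj : ∀ g h, j g h = j h g)
    (h2 : ∀ g : G, 2 • g = 0 → g = 0) {c ε : ℤ} (hε : ε = 1 ∨ ε = -1)
    (hc : (Fintype.card G : ℤ) = 4 * c + ε) {β : R4} (hβ : ((β : ℂˣ) : ℂ) ^ 2 = ε)
    (hT : LinearMap.trace ℂ (G → ℂ) (concreteFourier j) = ε * ((β : ℂˣ) : ℂ)) :
    RepresentsSpectrum (c • s + ε • br β) (concreteFourier j) := by
  classical
  refine ⟨concreteFourier_pow_four hj, fun α => ?_⟩
  have hr := four_mul_finrank_eigenspace_concreteFourier hj h2 (coe_pow_four α)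
  have hN := trace_mul_conj hj h2
  have hcC : (Fintype.card G : ℂ) = 4 * c + ε := by exact_mod_cast hc
  have hε2 : (ε : ℂ) * ε = 1 := by rcases hε with rfl | rfl <;> norm_num
  have hconj : starRingEnd ℂ (LinearMap.trace ℂ (G → ℂ) (concreteFourier j)) =
      ((β : ℂˣ) : ℂ) := by
    rw [hT] at hN ⊢
    have : (ε * ((β : ℂˣ) : ℂ)) * ((β : ℂˣ) : ℂ) = 1 := by
      rw [mul_assoc, ← sq, hβ, hε2]
    have h0 : (ε * ((β : ℂˣ) : ℂ)) ≠ 0 := left_ne_zero_of_mul_eq_one this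
    exact mul_left_cancel₀ h0 (hN.trans this.symm)
  rw [hconj, hT, hcC] at hr
  have hα := coe_pow_four α
  have e : (β = α) ↔ ((β : ℂˣ) : ℂ) = ((α : ℂˣ) : ℂ) :=
    ⟨fun h => by rw [h], coe_injective_R4⟩
  simp only [MonoidAlgebra.coeff_add, MonoidAlgebra.coeff_smul, Finsupp.add_apply,
    Finsupp.smul_apply, coeff_s, coeff_br, e]
  generalize ((α : ℂˣ) : ℂ) = a at *
  generalize ((β : ℂˣ) : ℂ) = b at *
  have : ((c + if b = a then ε else 0 : ℤ) : ℂ) =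
      (Module.finrank ℂ ((concreteFourier j).eigenspace a) : ℂ) := by
    refine mul_left_cancel₀ ((by norm_num : (4 : ℂ) ≠ 0)) ?_
    rw [hr]
    split_ifs with h
    · subst h
      push_cast
      linear_combination -(ε : ℂ) * hα - 2 * hβ
    -- Beyond `4 * c`, what remains is `b² + ab + a² + a³b³`; multiplication by `a - b` telescopes
    -- it to zero.
    · have hba : a - b ≠ 0 := fun h' => h (sub_eq_zero.1 h').symm
      refine mul_left_cancel₀ hba ?_
      push_cast
      linear_combination -(ε : ℂ) * b * hα + a ^ 3 * hε2 + (ε * a ^ 3 + a) * hβ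
  have h' : c + (if b = a then ε else 0) =
      (Module.finrank ℂ ((concreteFourier j).eigenspace a) : ℤ) := by exact_mod_cast this
  rw [← h']
  split_ifs <;> simp

end Represents

/-! ### Diagonal pairings and the classification -/

section DiagonalPairing

variable {p : ℕ} [Fact p.Prime]

/-- Each `a` has `1 + χ(a)` square roots, `χ` the quadratic character, and the `1` contributes a
vanishing full character sum. -/
theorem sum_addChar_mul_sq (hp : 2 < p) {ψ : AddChar (ZMod p) ℂ} (hψ : ψ ≠ 0) {c : ZMod p}
    (hc : c ≠ 0) :
    ∑ x, ψ (c * x ^ 2) = ∑ a, (quadraticChar (ZMod p) a : ℂ) * ψ (c * a) := by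
  classical
  have hF : ringChar (ZMod p) ≠ 2 := by rw [ZMod.ringChar_zmod_n]; omega
  have hsum : ∑ a, ψ (c * a) = 0 := by
    rw [← AddChar.sum_eq_zero_iff_ne_zero.2 hψ]
    exact Equiv.sum_comp (Equiv.mulLeft₀ c hc) ψ
  rw [← Finset.sum_fiberwise Finset.univ (fun x : ZMod p => x ^ 2), ← sub_zero (Finset.sum _ _),
    ← hsum, ← Finset.sum_sub_distrib]
  refine Finset.sum_congr rfl fun a _ => ?_
  have h : (((Finset.univ.filter fun x : ZMod p => x ^ 2 = a).card : ℤ)) =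
      quadraticChar (ZMod p) a + 1 := by
    rw [← quadraticChar_card_sqrts hF a]
    congr 2
    ext x
    simp
  have hC : ((Finset.univ.filter fun x : ZMod p => x ^ 2 = a).card : ℂ) =
      quadraticChar (ZMod p) a + 1 := by exact_mod_cast h
  rw [Finset.sum_congr rfl (g := fun _ => ψ (c * a))
    (fun x hx => by rw [(Finset.mem_filter.1 hx).2]), Finset.sum_const, nsmul_eq_mul, hC]
  ring

/-- Scaling by a nonsquare flips the sign of a quadratic Gauss sum. -/
theorem sum_addChar_nonsquare_mul_sq (hp : 2 < p) {ψ : AddChar (ZMod p) ℂ} (hψ : ψ ≠ 0)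
    {d : ZMod p} (hd : ¬ IsSquare d) : ∑ x, ψ (d * x ^ 2) = -∑ x, ψ (1 * x ^ 2) := by
  have hd0 : d ≠ 0 := fun h => hd (h ▸ IsSquare.zero)
  have hχ : quadraticChar (ZMod p) d = -1 := quadraticChar_neg_one_iff_not_isSquare.2 hd
  rw [sum_addChar_mul_sq hp hψ hd0, sum_addChar_mul_sq hp hψ one_ne_zero, ← Finset.sum_neg_distrib,
    ← Equiv.sum_comp (Equiv.mulLeft₀ d hd0)
      (fun a => -((quadraticChar (ZMod p) a : ℂ) * ψ (1 * a)))]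
  refine Finset.sum_congr rfl fun a _ => ?_
  rw [show Equiv.mulLeft₀ d hd0 a = d * a from rfl, map_mul (quadraticChar (ZMod p)), hχ, one_mul]
  push_cast
  ring

theorem stdAddChar_ne_zero : ZMod.stdAddChar (N := p) ≠ 0 := by
  refine AddChar.ne_zero_iff.2 ⟨1, fun h => ?_⟩
  rw [← (ZMod.stdAddChar (N := p)).map_zero_eq_one, ZMod.injective_stdAddChar.eq_iff] at h
  exact one_ne_zero h

/-- Testing on basis vectors gives injectivity; `G` and its dual have equal cardinality. -/
theorem exists_isMatrixOf_diagonal {m : ℕ} {d : Fin m → ZMod p} (hd : ∀ i, d i ≠ 0) :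
    ∃ j : (Fin m → ZMod p) ≃+ AddChar (Fin m → ZMod p) Circle,
      IsMatrixOf j (Matrix.diagonal d) := by
  classical
  let φ : (Fin m → ZMod p) →+ AddChar (Fin m → ZMod p) Circle :=
    AddMonoidHom.mk' (fun g => ZMod.toCircle.compAddMonoidHom
      (AddMonoidHom.mk' (fun h => h ⬝ᵥ (Matrix.diagonal d *ᵥ g)) fun a b => add_dotProduct a b _))
      (fun a b => by
        ext h : 1
        simp [Matrix.mulVec_add, dotProduct_add, AddChar.map_add_eq_mul])
  have hφ : ∀ g h, φ g h = ZMod.toCircle (h ⬝ᵥ (Matrix.diagonal d *ᵥ g)) := fun _ _ => rfl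
  have hinj : Function.Injective φ := by
    refine (injective_iff_map_eq_zero φ).2 fun g hg => funext fun i => ?_
    have h1 := DFunLike.congr_fun hg (Pi.single i 1)
    rw [hφ, AddChar.zero_apply, ← (ZMod.toCircle (N := p)).map_zero_eq_one,
      ZMod.injective_toCircle.eq_iff, single_dotProduct, one_mul, Matrix.mulVec_diagonal] at h1
    exact (mul_eq_zero.1 h1).resolve_left (hd i)
  have hcard : Nat.card (Fin m → ZMod p) = Nat.card (AddChar (Fin m → ZMod p) Circle) := by
    rw [Nat.card_congr AddChar.circleEquivComplex.toEquiv, Nat.card_eq_fintype_card,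
      Nat.card_eq_fintype_card, AddChar.card_eq]
  have : Finite (AddChar (Fin m → ZMod p) Circle) :=
    Finite.of_equiv _ AddChar.circleEquivComplex.toEquiv.symm
  exact ⟨AddEquiv.ofBijective φ ((Nat.bijective_iff_injective_and_card φ).2 ⟨hinj, hcard⟩), hφ⟩

theorem quadraticSum_eq_prod {m : ℕ} {d : Fin m → ZMod p}
    {j : (Fin m → ZMod p) ≃+ AddChar (Fin m → ZMod p) Circle}
    (hj : IsMatrixOf j (Matrix.diagonal d)) :
    quadraticSum j = ∏ i, ∑ x : ZMod p, ZMod.stdAddChar (d i * x ^ 2) := by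
  classical
  rw [Fintype.prod_sum, quadraticSum]
  refine Finset.sum_congr rfl fun g _ => ?_
  rw [hj g g, ← ZMod.stdAddChar_apply, dotProduct]
  refine (map_prod (ZMod.stdAddChar (N := p)).toMonoidHom
    (fun i => Multiplicative.ofAdd (g i * (Matrix.diagonal d *ᵥ g) i)) Finset.univ).trans ?_
  refine Finset.prod_congr rfl fun i _ => ?_
  rw [Matrix.mulVec_diagonal, AddChar.toMonoidHom_apply, toAdd_ofAdd]
  congr 1
  ring

/-- Two diagonal pairings whose quadratic sums are opposite. -/
theorem exists_opposite_quadraticSums {m : ℕ} (hp : 2 < p) (hm : 1 ≤ m) :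
    ∃ (j k : (Fin m → ZMod p) ≃+ AddChar (Fin m → ZMod p) Circle)
      (M N : Matrix (Fin m) (Fin m) (ZMod p)), IsMatrixOf j M ∧ M.IsSymm ∧ IsMatrixOf k N ∧
        N.IsSymm ∧ quadraticSum k = -quadraticSum j := by
  classical
  have hF : ringChar (ZMod p) ≠ 2 := by rw [ZMod.ringChar_zmod_n]; omega
  obtain ⟨d, hd⟩ := FiniteField.exists_nonsquare hF
  have hd0 : d ≠ 0 := fun h => hd (h ▸ IsSquare.zero)
  let i₀ : Fin m := ⟨0, hm⟩
  obtain ⟨j, hj⟩ := exists_isMatrixOf_diagonal (p := p) (m := m) (d := fun _ => 1)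
    fun _ => one_ne_zero
  -- Exactly one factor of the product of Gauss sums changes sign.
  obtain ⟨k, hk⟩ := exists_isMatrixOf_diagonal (p := p) (m := m) (d := Function.update 1 i₀ d)
    fun i => by
      rcases eq_or_ne i i₀ with rfl | h
      · simpa using hd0
      · simp [h]
  refine ⟨j, k, _, _, hj, Matrix.isSymm_diagonal _, hk, Matrix.isSymm_diagonal _, ?_⟩
  rw [quadraticSum_eq_prod hj, quadraticSum_eq_prod hk, ← Finset.mul_prod_erase _ _
    (Finset.mem_univ i₀), ← Finset.mul_prod_erase _ _ (Finset.mem_univ i₀), ← neg_mul]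
  congr 1
  · rw [Function.update_self]
    exact sum_addChar_nonsquare_mul_sq hp stdAddChar_ne_zero hd
  · refine Finset.prod_congr rfl fun i hi => ?_
    simp [Finset.ne_of_mem_erase hi]

theorem two_nsmul_eq_zero {m : ℕ} (hp : 2 < p) (g : Fin m → ZMod p) (h : 2 • g = 0) : g = 0 := by
  funext i
  have h2 : (2 : ZMod p) ≠ 0 := by
    intro h
    have := (ZMod.natCast_eq_zero_iff 2 p).1 (by exact_mod_cast h)
    exact absurd (Nat.le_of_dvd two_pos this) (by omega)
  have := congrFun h i
  rw [Pi.smul_apply, nsmul_eq_mul] at this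
  exact (mul_eq_zero.1 this).resolve_left (by exact_mod_cast h2)

theorem IsMatrixOf.comm {m : ℕ} {j : (Fin m → ZMod p) ≃+ AddChar (Fin m → ZMod p) Circle}
    {M : Matrix (Fin m) (Fin m) (ZMod p)} (hj : IsMatrixOf j M) (hM : M.IsSymm)
    (g h : Fin m → ZMod p) : j g h = j h g := by
  rw [hj, hj, Matrix.dotProduct_mulVec, ← Matrix.mulVec_transpose, hM.eq, dotProduct_comm]

/-- The spectra for all symmetric pairings, in terms of a square root `β` of the sign `ε`
with `p ^ m ≡ ε` modulo `4`. -/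
theorem spectrum_classification {m : ℕ} (hp : 2 < p) (hm : 1 ≤ m) {c ε : ℤ}
    (hε : ε = 1 ∨ ε = -1) (hc : (p : ℤ) ^ m = 4 * c + ε) {β : R4}
    (hβ : ((β : ℂˣ) : ℂ) ^ 2 = ε) :
    (∀ (j : (Fin m → ZMod p) ≃+ AddChar (Fin m → ZMod p) Circle)
        (M : Matrix (Fin m) (Fin m) (ZMod p)), IsMatrixOf j M → M.IsSymm →
      RepresentsSpectrum (c • s + ε • br β) (concreteFourier j) ∨
        RepresentsSpectrum (c • s + ε • br (negOne * β)) (concreteFourier j)) ∧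
    (∃ (j : (Fin m → ZMod p) ≃+ AddChar (Fin m → ZMod p) Circle)
        (M : Matrix (Fin m) (Fin m) (ZMod p)), IsMatrixOf j M ∧ M.IsSymm ∧
      RepresentsSpectrum (c • s + ε • br β) (concreteFourier j)) ∧
    (∃ (j : (Fin m → ZMod p) ≃+ AddChar (Fin m → ZMod p) Circle)
        (M : Matrix (Fin m) (Fin m) (ZMod p)), IsMatrixOf j M ∧ M.IsSymm ∧
      RepresentsSpectrum (c • s + ε • br (negOne * β)) (concreteFourier j)) := by
  have hcard : (Fintype.card (Fin m → ZMod p) : ℤ) = 4 * c + ε := by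
    rw [← hc, Fintype.card_fun, ZMod.card, Fintype.card_fin, Nat.cast_pow]
  have hε2 : (ε : ℂ) * ε = 1 := by rcases hε with rfl | rfl <;> norm_num
  have hneg : (((negOne * β : R4) : ℂˣ) : ℂ) = -((β : ℂˣ) : ℂ) := by
    rw [Subgroup.coe_mul, Units.val_mul, coe_negOne, neg_one_mul]
  have two := two_nsmul_eq_zero (m := m) hp
  have pos : ∀ (j : (Fin m → ZMod p) ≃+ AddChar (Fin m → ZMod p) Circle),
      (∀ g h, j g h = j h g) →
      LinearMap.trace ℂ _ (concreteFourier j) = ε * ((β : ℂˣ) : ℂ) →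
      RepresentsSpectrum (c • s + ε • br β) (concreteFourier j) :=
    fun j hj hT => representsSpectrum_of_trace hj two hε hcard hβ hT
  have neg : ∀ (j : (Fin m → ZMod p) ≃+ AddChar (Fin m → ZMod p) Circle),
      (∀ g h, j g h = j h g) →
      LinearMap.trace ℂ _ (concreteFourier j) = -(ε * ((β : ℂˣ) : ℂ)) →
      RepresentsSpectrum (c • s + ε • br (negOne * β)) (concreteFourier j) :=
    fun j hj hT => representsSpectrum_of_trace hj two hε hcard (by rw [hneg, neg_sq, hβ])
      (by rw [hT, hneg, mul_neg])
  have dich : ∀ (j : (Fin m → ZMod p) ≃+ AddChar (Fin m → ZMod p) Circle),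
      (∀ g h, j g h = j h g) →
      LinearMap.trace ℂ _ (concreteFourier j) = ε * ((β : ℂˣ) : ℂ) ∨
        LinearMap.trace ℂ _ (concreteFourier j) = -(ε * ((β : ℂˣ) : ℂ)) := by
    intro j hj
    rw [← sq_eq_sq_iff_eq_or_eq_neg, trace_concreteFourier_sq_eq hj two hε hcard, mul_pow, hβ, sq,
      hε2, one_mul]
  refine ⟨fun j M hj hM => (dich j (hj.comm hM)).imp (pos j (hj.comm hM)) (neg j (hj.comm hM)), ?_⟩
  obtain ⟨j, k, M, N, hj, hM, hk, hN, hjk⟩ := exists_opposite_quadraticSums (p := p) hp hm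
  have hT : LinearMap.trace ℂ _ (concreteFourier k) =
      -LinearMap.trace ℂ _ (concreteFourier j) := by
    rw [trace_concreteFourier, trace_concreteFourier, hjk, mul_neg]
  -- Which of `j`, `k` has which trace is left undecided; either assignment yields both spectra.
  rcases dich j (hj.comm hM) with h | h <;> rw [h] at hT
  · exact ⟨⟨j, M, hj, hM, pos j (hj.comm hM) h⟩, ⟨k, N, hk, hN, neg k (hk.comm hN) hT⟩⟩
  · rw [neg_neg] at hT
    exact ⟨⟨k, N, hk, hN, pos k (hk.comm hN) hT⟩, ⟨j, M, hj, hM, neg j (hj.comm hM) h⟩⟩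

end DiagonalPairing

end FourierIso

end

/-! ### The two residue classes modulo 4 -/

theorem mainTheorem3 (p m : ℕ) [Fact p.Prime] (hp : 2 < p) (hm : 1 ≤ m) :
    (p ≡ 1 [MOD 4] →
      (∀ (j : (Fin m → ZMod p) ≃+ AddChar (Fin m → ZMod p) Circle)
          (M : Matrix (Fin m) (Fin m) (ZMod p)), FourierIso.IsMatrixOf j M → M.IsSymm →
        FourierIso.RepresentsSpectrum
            ((((p : ℤ) ^ m - 1) / 4) • FourierIso.s + FourierIso.br 1)
            (FourierIso.concreteFourier j) ∨
          FourierIso.RepresentsSpectrum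
            ((((p : ℤ) ^ m - 1) / 4) • FourierIso.s + FourierIso.br FourierIso.negOne)
            (FourierIso.concreteFourier j)) ∧
      (∃ (j : (Fin m → ZMod p) ≃+ AddChar (Fin m → ZMod p) Circle)
          (M : Matrix (Fin m) (Fin m) (ZMod p)), FourierIso.IsMatrixOf j M ∧ M.IsSymm ∧
        FourierIso.RepresentsSpectrum
          ((((p : ℤ) ^ m - 1) / 4) • FourierIso.s + FourierIso.br 1)
          (FourierIso.concreteFourier j)) ∧
      (∃ (j : (Fin m → ZMod p) ≃+ AddChar (Fin m → ZMod p) Circle)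
          (M : Matrix (Fin m) (Fin m) (ZMod p)), FourierIso.IsMatrixOf j M ∧ M.IsSymm ∧
        FourierIso.RepresentsSpectrum
          ((((p : ℤ) ^ m - 1) / 4) • FourierIso.s + FourierIso.br FourierIso.negOne)
          (FourierIso.concreteFourier j))) ∧
    (p ≡ 3 [MOD 4] →
      (∀ (j : (Fin m → ZMod p) ≃+ AddChar (Fin m → ZMod p) Circle)
          (M : Matrix (Fin m) (Fin m) (ZMod p)), FourierIso.IsMatrixOf j M → M.IsSymm →
        FourierIso.RepresentsSpectrum
            ((((p : ℤ) ^ m - (-1) ^ m) / 4) • FourierIso.s +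
              ((-1 : ℤ) ^ m) • FourierIso.br (FourierIso.imag ^ m))
            (FourierIso.concreteFourier j) ∨
          FourierIso.RepresentsSpectrum
            ((((p : ℤ) ^ m - (-1) ^ m) / 4) • FourierIso.s +
              ((-1 : ℤ) ^ m) • FourierIso.br (FourierIso.negOne * FourierIso.imag ^ m))
            (FourierIso.concreteFourier j)) ∧
      (∃ (j : (Fin m → ZMod p) ≃+ AddChar (Fin m → ZMod p) Circle)
          (M : Matrix (Fin m) (Fin m) (ZMod p)), FourierIso.IsMatrixOf j M ∧ M.IsSymm ∧
        FourierIso.RepresentsSpectrum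
          ((((p : ℤ) ^ m - (-1) ^ m) / 4) • FourierIso.s +
            ((-1 : ℤ) ^ m) • FourierIso.br (FourierIso.imag ^ m))
          (FourierIso.concreteFourier j)) ∧
      (∃ (j : (Fin m → ZMod p) ≃+ AddChar (Fin m → ZMod p) Circle)
          (M : Matrix (Fin m) (Fin m) (ZMod p)), FourierIso.IsMatrixOf j M ∧ M.IsSymm ∧
        FourierIso.RepresentsSpectrum
          ((((p : ℤ) ^ m - (-1) ^ m) / 4) • FourierIso.s +
            ((-1 : ℤ) ^ m) • FourierIso.br (FourierIso.negOne * FourierIso.imag ^ m))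
          (FourierIso.concreteFourier j))) := by
  constructor
  · intro hp1
    have hmod : (4 : ℤ) ∣ (p : ℤ) ^ m - 1 := by
      have h : (1 : ℤ) ≡ (p : ℤ) [ZMOD 4] := ((Int.natCast_modEq_iff (n := 4)).2 hp1).symm
      simpa using (h.pow m).dvd
    have hc : (p : ℤ) ^ m = 4 * (((p : ℤ) ^ m - 1) / 4) + 1 := by
      rw [Int.mul_ediv_cancel' hmod]
      ring
    have h := FourierIso.spectrum_classification hp hm (Or.inl rfl) hc (β := 1) (by simp)
    simpa only [one_smul, mul_one] using h
  · intro hp3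
    have hmod : (4 : ℤ) ∣ (p : ℤ) ^ m - (-1) ^ m := by
      have h : (p : ℤ) ≡ -1 [ZMOD 4] :=
        ((Int.natCast_modEq_iff (n := 4)).2 hp3).trans (by decide)
      exact (h.symm.pow m).dvd
    have hc : (p : ℤ) ^ m = 4 * (((p : ℤ) ^ m - (-1) ^ m) / 4) + (-1) ^ m := by
      rw [Int.mul_ediv_cancel' hmod]
      ring
    -- Here `ε = (-1) ^ m`, and `β = i ^ m` is a square root of it.
    refine FourierIso.spectrum_classification hp hm (neg_one_pow_eq_or ℤ m) hc
      (β := FourierIso.imag ^ m) ?_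
    rw [SubmonoidClass.coe_pow, Units.val_pow_eq_pow_val, FourierIso.coe_imag, ← pow_mul, mul_comm,
      pow_mul, Complex.I_sq]
    push_cast
    rfl
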